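/- Consider a stage game with finitely many players $N=\{1,\dots,n\}$, finite action sets $A_i$, finite private signal sets $S_i$ and finite message sets $M_i$; write $A=\prod_i A_i$, $S=\prod_i S_i$, $M=\prod_i M_i$. Payoffs are $g:A\to\mathbb R^n$, and given $a\in A$ the private signal profile is drawn from $p(\cdot\mid a)\in\Delta(S)$, where each marginal has full support: $\sum_{s_{-i}}p(s_i,s_{-i}\mid a)>0$ for all $i$, $s_i\in S_i$, $a\in A$. A message strategy of player $i$ is a map $\rho_i:S_i\to M_i$; let $R_i$ be the set of these. For $a\in A$ and $\rho\in\prod_iR_i$ let $$\tilde p(m\mid a,\rho)=\sum_{s\in S:\ \rho_i(s_i)=m_i\ \forall i}p(s\mid a),\qquad m\in M .$$ The game is repeated in periods $t=1,2,\dots$ with discount factor $\delta\in(0,1)$, and the messages sent in each period are public. A public history $h$ is a finite (possibly empty) sequence of message profiles. A (pure) public strategy $\sigma_i=(\sigma_i^a,\sigma_i^m)$ of player $i$ assigns to each public history $h$ an action $\sigma_i^a(h)\in A_i$ and to each $h$ and $a_i\in A_i$ a message strategy $\sigma_i^m(h,a_i)\in R_i$; put $\sigma_i(h)=(\sigma^a_i(h),\sigma^m_i(h,\sigma^a_i(h)))$.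 Let $w^\sigma(h)\in\mathbb R^n$ be the profile of expected discounted average continuation payoffs at $h$, that is, $w_i^\sigma(h)=(1-\delta)\,E\big[\sum_{k\ge0}\delta^{k}g_i(\tilde a^{k})\mid h,\sigma\big]$, where $\tilde a^{k}$ is the action profile played $k$ periods after $h$. At a public history $h$, a deviation $(a_i',\rho_i')\in A_i\times R_i$ of player $i$ is nontrivial if $a_i'\ne\sigma_i^a(h)$ or if the unilateral deviation from $\sigma_i(h)$ to $(a_i',\rho_i')$ changes the probability distribution of the continuation payoff profile $w^\sigma(h,m)$ (as a random vector in $\mathbb R^n$, with $m$ drawn from $\tilde p$). For $\eta\ge0$, a profile $\sigma$ of public strategies is an $\eta$-uniformly strict perfect public equilibrium ($\eta$-USPPE) if for every public history $h$, every player $i$ and every nontrivial deviation $(a_i',\rho_i')$ of $i$ at $h$, $$g_i(\sigma^a(h))+\frac{\delta}{1-\delta}\sum_{m\in M}w_i^\sigma(h,m)\,\tilde p(m\mid\sigma(h))-\eta\ \ge\ g_i(a_i',\sigma_{-i}^a(h))+\frac{\delta}{1-\delta}\sum_{m\in M}w_i^\sigma(h,m)\,\tilde p\big(m\mid(a_i',\rho_i'),\sigma_{-i}(h)\big).$$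 Let $E^\eta(\delta)\subset\mathbb R^n$ be the (possibly empty) set of payoff profiles $w^\sigma(\varnothing)$ of all $\eta$-USPPE $\sigma$ for the discount factor $\delta$. Then for every $\eta\ge0$ and every $\delta\in(0,1)$, the set $E^\eta(\delta)$ is compact. -/

import Mathlib

/-- A stage game with private monitoring. The players are `Fin n`, player `i` has actions `A i` and
private signals `S i`; `g a i` is the stage payoff of player `i`, and `p a` is the distribution of
the signal profile given the action profile `a`, all of whose marginals have full support. -/
structure MonitoringGame (n : ℕ) (A S : Fin n → Type*) [∀ i, Fintype (S i)] where
  g : (∀ i, A i) → Fin n → ℝ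
  p : (∀ i, A i) → (∀ i, S i) → ℝ
  p_nonneg : ∀ a s, 0 ≤ p a s
  p_sum : ∀ a, ∑ s, p a s = 1
  full_support : ∀ (a : ∀ i, A i) (i : Fin n) (x : S i), open Classical in
    0 < ∑ s : (∀ j, S j) with s i = x, p a s

/-- A pure public strategy of player `i`. A public history is the list of the message profiles of
the past periods, oldest first. The message component depends on the public history and on the own
action just taken, and its value is a message strategy `S i → M i` of the stage game. -/
structure PublicStrategy {n : ℕ} (A S M : Fin n → Type*) (i : Fin n) where
  act : List (∀ j, M j) → A i
  msg : List (∀ j, M j) → A i → (S i → M i)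

/-- The action profile prescribed at the public history `h`. -/
def actionsAt {n : ℕ} {A S M : Fin n → Type*} (σ : ∀ i, PublicStrategy A S M i)
    (h : List (∀ j, M j)) : ∀ i, A i :=
  fun i => (σ i).act h

/-- The profile of on-path message strategies prescribed at the public history `h`. -/
def messagesAt {n : ℕ} {A S M : Fin n → Type*} (σ : ∀ i, PublicStrategy A S M i)
    (h : List (∀ j, M j)) : ∀ i, S i → M i :=
  fun i => (σ i).msg h ((σ i).act h)

namespace MonitoringGame

variable {n : ℕ} {A S M : Fin n → Type*} [∀ i, Fintype (S i)] [∀ i, Fintype (M i)]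

open Classical in
/-- The probability of the public message profile `m` when the action profile is `a` and the
profile of message strategies is `ρ`. -/
noncomputable def messageProb (G : MonitoringGame n A S) (a : ∀ i, A i) (ρ : ∀ i, S i → M i)
    (m : ∀ i, M i) : ℝ :=
  ∑ s : (∀ i, S i) with (∀ i, ρ i (s i) = m i), G.p a s

/-- The probability that, starting from the public history `h`, the message profiles of the next
`k` periods are `μ 0, …, μ (k - 1)`, when all players follow `σ`. -/
noncomputable def pathProb (G : MonitoringGame n A S) (σ : ∀ i, PublicStrategy A S M i)
    (h : List (∀ j, M j)) (k : ℕ) (μ : Fin k → (∀ j, M j)) : ℝ :=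
  ∏ t : Fin k, G.messageProb (actionsAt σ (h ++ (List.ofFn μ).take t))
    (messagesAt σ (h ++ (List.ofFn μ).take t)) (μ t)

/-- The expected stage payoff of player `i`, `k` periods after the public history `h`. -/
noncomputable def expectedStagePayoff (G : MonitoringGame n A S)
    (σ : ∀ i, PublicStrategy A S M i) (h : List (∀ j, M j)) (k : ℕ) (i : Fin n) : ℝ :=
  ∑ μ : Fin k → (∀ j, M j), G.pathProb σ h k μ * G.g (actionsAt σ (h ++ List.ofFn μ)) i

/-- The profile of expected discounted average continuation payoffs at the public history `h`. -/
noncomputable def contPayoff (G : MonitoringGame n A S) (δ : ℝ)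
    (σ : ∀ i, PublicStrategy A S M i) (h : List (∀ j, M j)) : Fin n → ℝ :=
  fun i => (1 - δ) * ∑' k : ℕ, δ ^ k * G.expectedStagePayoff σ h k i

open Classical in
/-- The distribution of the random vector `w m`, when the message profile `m` is generated by the
action profile `a` and the message strategies `ρ`: the probability that `w m = v`. -/
noncomputable def continuationLaw (G : MonitoringGame n A S) (a : ∀ i, A i) (ρ : ∀ i, S i → M i)
    (w : (∀ i, M i) → (Fin n → ℝ)) (v : Fin n → ℝ) : ℝ :=
  ∑ m : (∀ i, M i) with w m = v, G.messageProb a ρ m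

/-- `(a', ρ')` is a nontrivial deviation of player `i` from `(a, ρ)` with respect to the
continuation payoffs `w`: it changes the own action, or it changes the distribution of the
continuation payoff profile. -/
def IsNontrivialDeviation (G : MonitoringGame n A S) (a : ∀ i, A i) (ρ : ∀ i, S i → M i)
    (w : (∀ i, M i) → (Fin n → ℝ)) (i : Fin n) (a' : A i) (ρ' : S i → M i) : Prop :=
  a' ≠ a i ∨
    G.continuationLaw (Function.update a i a') (Function.update ρ i ρ') w ≠ G.continuationLaw a ρ w

/-- `σ` is an `η`-uniformly strict perfect public equilibrium for the discount factor `δ`. -/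
def IsUSPPE (G : MonitoringGame n A S) (η δ : ℝ) (σ : ∀ i, PublicStrategy A S M i) : Prop :=
  ∀ (h : List (∀ j, M j)) (i : Fin n) (a' : A i) (ρ' : S i → M i),
    G.IsNontrivialDeviation (actionsAt σ h) (messagesAt σ h)
      (fun m => G.contPayoff δ σ (h ++ [m])) i a' ρ' →
    G.g (Function.update (actionsAt σ h) i a') i
        + δ / (1 - δ) * ∑ m : (∀ j, M j), G.contPayoff δ σ (h ++ [m]) i *
            G.messageProb (Function.update (actionsAt σ h) i a')
              (Function.update (messagesAt σ h) i ρ') m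
      ≤ G.g (actionsAt σ h) i
        + δ / (1 - δ) * ∑ m : (∀ j, M j), G.contPayoff δ σ (h ++ [m]) i *
            G.messageProb (actionsAt σ h) (messagesAt σ h) m
        - η

/-- The set of payoff profiles of `η`-uniformly strict perfect public equilibria of the repeated
game with message sets `M` and discount factor `δ`. -/
def usppePayoffs (G : MonitoringGame n A S) (M : Fin n → Type*) [∀ i, Fintype (M i)]
    (η δ : ℝ) : Set (Fin n → ℝ) :=
  {v | ∃ σ : ∀ i, PublicStrategy A S M i, G.IsUSPPE η δ σ ∧ G.contPayoff δ σ [] = v}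

end MonitoringGame

namespace MonitoringGame

section Probability

variable {n : ℕ} {A S M : Fin n → Type*} [∀ i, Fintype (S i)]

/-! Pure public strategy profiles form a product of finite discrete sets, hence a compact space.
There the prescription at any one history is locally constant, and discounting makes every
continuation payoff continuous (`continuous_contPayoff`). Equilibria form a closed set
(`isClosed_setOf_isUSPPE`), so the payoff set is a continuous image of a compact set. The delicate
point is that being a trivial deviation must survive limits although the continuation payoffs move;
`continuationLaw_eq_iff` settles it. -/

theorem messageProb_nonneg (G : MonitoringGame n A S) (a : ∀ i, A i) (ρ : ∀ i, S i → M i)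
    (m : ∀ i, M i) : 0 ≤ G.messageProb a ρ m :=
  Finset.sum_nonneg fun s _ => G.p_nonneg a s

theorem pathProb_nonneg (G : MonitoringGame n A S) (σ : ∀ i, PublicStrategy A S M i)
    (h : List (∀ j, M j)) (k : ℕ) (μ : Fin k → (∀ j, M j)) : 0 ≤ G.pathProb σ h k μ :=
  Finset.prod_nonneg fun _ _ => G.messageProb_nonneg _ _ _

theorem pathProb_cons (G : MonitoringGame n A S) (σ : ∀ i, PublicStrategy A S M i)
    (h : List (∀ j, M j)) (k : ℕ) (m : ∀ j, M j) (μ : Fin k → (∀ j, M j)) :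
    G.pathProb σ h (k + 1) (Fin.cons m μ) =
      G.messageProb (actionsAt σ h) (messagesAt σ h) m * G.pathProb σ (h ++ [m]) k μ := by
  simp [pathProb, Fin.prod_univ_succ, List.ofFn_succ]

variable [∀ i, Fintype (M i)]

theorem sum_messageProb (G : MonitoringGame n A S) (a : ∀ i, A i) (ρ : ∀ i, S i → M i) :
    ∑ m, G.messageProb a ρ m = 1 := by
  classical
  rw [← G.p_sum a, ← Finset.sum_fiberwise Finset.univ (fun s i => ρ i (s i)) (G.p a)]
  refine Finset.sum_congr rfl fun m _ => ?_
  unfold messageProb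
  refine Finset.sum_congr ?_ fun _ _ => rfl
  ext s
  simp [funext_iff]

theorem sum_pathProb (G : MonitoringGame n A S) (σ : ∀ i, PublicStrategy A S M i)
    (h : List (∀ j, M j)) (k : ℕ) : ∑ μ, G.pathProb σ h k μ = 1 := by
  induction k generalizing h with
  | zero => simp [pathProb]
  | succ k ih =>
    rw [← (Fin.consEquiv fun _ : Fin (k + 1) => ∀ j, M j).sum_comp, Fintype.sum_prod_type]
    rw [← G.sum_messageProb (actionsAt σ h) (messagesAt σ h)]
    refine Finset.sum_congr rfl fun m _ => ?_
    rw [← mul_one (G.messageProb _ _ m), ← ih (h ++ [m]), Finset.mul_sum]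
    exact Finset.sum_congr rfl fun μ _ => G.pathProb_cons σ h k m μ

theorem abs_expectedStagePayoff_le (G : MonitoringGame n A S)
    (σ : ∀ i, PublicStrategy A S M i) (h : List (∀ j, M j)) (k : ℕ) (i : Fin n) {C : ℝ}
    (hC : ∀ a, |G.g a i| ≤ C) : |G.expectedStagePayoff σ h k i| ≤ C :=
  calc |G.expectedStagePayoff σ h k i|
      ≤ ∑ μ : Fin k → (∀ j, M j), |G.pathProb σ h k μ * G.g (actionsAt σ (h ++ List.ofFn μ)) i| :=
        Finset.abs_sum_le_sum_abs _ _
    _ ≤ ∑ μ : Fin k → (∀ j, M j), G.pathProb σ h k μ * C := by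
        refine Finset.sum_le_sum fun μ _ => ?_
        rw [abs_mul, abs_of_nonneg (G.pathProb_nonneg σ h k μ)]
        exact mul_le_mul_of_nonneg_left (hC _) (G.pathProb_nonneg σ h k μ)
    _ = C := by rw [← Finset.sum_mul, sum_pathProb, one_mul]

open Classical in
theorem sum_mul_continuationLaw (G : MonitoringGame n A S) (a : ∀ i, A i) (ρ : ∀ i, S i → M i)
    (w : (∀ i, M i) → (Fin n → ℝ)) (f : (Fin n → ℝ) → ℝ) :
    ∑ v ∈ Finset.univ.image w, f v * G.continuationLaw a ρ w v =
      ∑ m, f (w m) * G.messageProb a ρ m := by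
  rw [← Finset.sum_fiberwise_of_maps_to (t := Finset.univ.image w) (g := w)
    (fun m _ => Finset.mem_image_of_mem w (Finset.mem_univ m))]
  refine Finset.sum_congr rfl fun v _ => ?_
  rw [continuationLaw, Finset.mul_sum]
  refine Finset.sum_congr rfl fun m hm => ?_
  rw [(Finset.mem_filter.mp hm).2]

/-- Laws of the continuation payoffs agree if and only if they give the same expectation to every
continuous function. -/
theorem continuationLaw_eq_iff (G : MonitoringGame n A S) (a a' : ∀ i, A i)
    (ρ ρ' : ∀ i, S i → M i) (w : (∀ i, M i) → (Fin n → ℝ)) :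
    G.continuationLaw a' ρ' w = G.continuationLaw a ρ w ↔
      ∀ f : C(Fin n → ℝ, ℝ),
        ∑ m, f (w m) * G.messageProb a' ρ' m = ∑ m, f (w m) * G.messageProb a ρ m := by
  classical
  constructor
  · intro hlaw f
    rw [← sum_mul_continuationLaw, ← sum_mul_continuationLaw, hlaw]
  · intro hf
    funext v
    -- `w` has finitely many values, so an Urysohn function can isolate `v` among them; its
    -- expectation is the mass at `v`.
    obtain ⟨f, hf₀, hf₁, -⟩ := exists_continuous_zero_one_of_isClosed
      (s := ((Finset.univ.image w).erase v : Set (Fin n → ℝ))) (t := {v})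
      (Finset.finite_toSet _).isClosed isClosed_singleton (by simp)
    have key : ∀ m, f (w m) = if w m = v then 1 else 0 := by
      intro m
      split_ifs with hm
      · exact hf₁ hm
      · exact hf₀ (by simp [hm])
    simpa [key, continuationLaw, Finset.sum_filter] using hf f

end Probability

section Continuity

variable {n : ℕ} {A S M : Fin n → Type*} [∀ i, Fintype (S i)]
  {X : Type*} [TopologicalSpace X] {σ : X → ∀ i, PublicStrategy A S M i}

theorem continuous_messageProb (G : MonitoringGame n A S) {a : X → ∀ i, A i}
    {ρ : X → ∀ i, S i → M i} (ha : IsLocallyConstant a) (hρ : IsLocallyConstant ρ)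
    (m : ∀ i, M i) : Continuous fun x => G.messageProb (a x) (ρ x) m :=
  (ha.comp₂ hρ fun a ρ => G.messageProb a ρ m).continuous

variable [∀ i, Fintype (M i)]

theorem continuous_expectedStagePayoff (G : MonitoringGame n A S)
    (ha : ∀ h, IsLocallyConstant fun x => actionsAt (σ x) h)
    (hm : ∀ h, IsLocallyConstant fun x => messagesAt (σ x) h)
    (h : List (∀ j, M j)) (k : ℕ) (i : Fin n) :
    Continuous fun x => G.expectedStagePayoff (σ x) h k i :=
  continuous_finsetSum _ fun _ _ =>
    (continuous_finsetProd _ fun _ _ => G.continuous_messageProb (ha _) (hm _) _).mul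
      ((ha _).comp fun a => G.g a i).continuous

theorem continuous_contPayoff [∀ i, Finite (A i)] (G : MonitoringGame n A S) {δ : ℝ}
    (hδ₀ : 0 ≤ δ) (hδ₁ : δ < 1)
    (ha : ∀ h, IsLocallyConstant fun x => actionsAt (σ x) h)
    (hm : ∀ h, IsLocallyConstant fun x => messagesAt (σ x) h) (h : List (∀ j, M j)) :
    Continuous fun x => G.contPayoff δ (σ x) h := by
  refine continuous_pi fun i => continuous_const.mul ?_
  obtain ⟨C, hC⟩ := (Set.finite_range fun a => |G.g a i|).bddAbove
  -- Weierstrass M-test: `C` bounds the stage payoffs over the finite set of action profiles.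
  refine continuous_tsum (u := fun k => δ ^ k * C)
    (fun k => continuous_const.mul (G.continuous_expectedStagePayoff ha hm h k i))
    ((summable_geometric_of_lt_one hδ₀ hδ₁).mul_right C) fun k x => ?_
  rw [Real.norm_eq_abs, abs_mul, abs_of_nonneg (pow_nonneg hδ₀ k)]
  exact mul_le_mul_of_nonneg_left
    (G.abs_expectedStagePayoff_le _ _ _ _ fun a => hC ⟨a, rfl⟩) (pow_nonneg hδ₀ k)

theorem isClosed_setOf_isUSPPE [∀ i, Finite (A i)] (G : MonitoringGame n A S) (η : ℝ) {δ : ℝ}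
    (hδ₀ : 0 ≤ δ) (hδ₁ : δ < 1)
    (ha : ∀ h, IsLocallyConstant fun x => actionsAt (σ x) h)
    (hm : ∀ h, IsLocallyConstant fun x => messagesAt (σ x) h) :
    IsClosed {x | G.IsUSPPE η δ (σ x)} := by
  simp only [IsUSPPE, Set.ofPred_forall]
  refine isClosed_iInter fun h => isClosed_iInter fun i => isClosed_iInter fun a' =>
    isClosed_iInter fun ρ' => ?_
  have hw := fun m => G.continuous_contPayoff hδ₀ hδ₁ ha hm (h ++ [m])
  have hwi := fun m => (continuous_apply i).comp (hw m)
  have ha' := (ha h).comp fun a => Function.update a i a'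
  have hm' := (hm h).comp fun ρ => Function.update ρ i ρ'
  have hP := fun m => G.continuous_messageProb (ha h) (hm h) m
  have hP' := fun m => G.continuous_messageProb ha' hm' m
  -- Each incentive constraint reads "trivial deviation or weak inequality", a union of two sets to
  -- be shown closed.
  simp only [imp_iff_not_or, Set.ofPred_or]
  refine IsClosed.union ?_ (isClosed_le ?_ ?_)
  -- The mass at a fixed `v` can jump as the payoffs vary, but expectations of continuous test
  -- functions cannot.
  · simp only [IsNontrivialDeviation, not_or, not_not, continuationLaw_eq_iff, Set.ofPred_and,
      Set.ofPred_forall]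
    refine IsClosed.inter ?_ (isClosed_iInter fun f => isClosed_eq ?_ ?_)
    · exact ⟨ha h {a | a' = a i}ᶜ⟩
    · exact continuous_finsetSum _ fun m _ => (f.continuous.comp (hw m)).mul (hP' m)
    · exact continuous_finsetSum _ fun m _ => (f.continuous.comp (hw m)).mul (hP m)
  · exact (ha'.comp fun a => G.g a i).continuous.add (continuous_const.mul
      (continuous_finsetSum _ fun m _ => (hwi m).mul (hP' m)))
  · exact (((ha h).comp fun a => G.g a i).continuous.add (continuous_const.mul
      (continuous_finsetSum _ fun m _ => (hwi m).mul (hP m)))).sub continuous_const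

end Continuity

end MonitoringGame

theorem mainTheorem4 {n : ℕ} {A S M : Fin n → Type*} [∀ i, Fintype (A i)] [∀ i, Fintype (S i)]
    [∀ i, Fintype (M i)] (G : MonitoringGame n A S) (η δ : ℝ) (hη : 0 ≤ η) (hδ₀ : 0 < δ)
    (hδ₁ : δ < 1) :
    IsCompact (G.usppePayoffs M η δ) := by
  let : ∀ i, TopologicalSpace (A i) := fun _ => ⊥
  let : ∀ i, TopologicalSpace (M i) := fun _ => ⊥
  have : ∀ i, DiscreteTopology (A i) := fun _ => ⟨rfl⟩
  have : ∀ i, DiscreteTopology (M i) := fun _ => ⟨rfl⟩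
  let X := ∀ i, (List (∀ j, M j) → A i) × (List (∀ j, M j) → A i → S i → M i)
  let σ : X → ∀ i, PublicStrategy A S M i := fun x i => ⟨(x i).1, (x i).2⟩
  have ha : ∀ h, IsLocallyConstant fun x => actionsAt (σ x) h := fun h =>
    (IsLocallyConstant.iff_continuous fun (x : X) i => (x i).1 h).2 (by fun_prop)
  have hm : ∀ h, IsLocallyConstant fun x => messagesAt (σ x) h := by
    intro h
    -- At a fixed `h`, the message rules for all own actions range over a finite discrete space,
    -- since actions and signals are finite.
    have hmsg : IsLocallyConstant fun (x : X) i => (x i).2 h :=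
      (IsLocallyConstant.iff_continuous _).2 (by fun_prop)
    exact (ha h).comp₂ hmsg fun a r i => r i (a i)
  have hE : G.usppePayoffs M η δ =
      (fun x => G.contPayoff δ (σ x) []) '' {x | G.IsUSPPE η δ (σ x)} := by
    ext v
    constructor
    · rintro ⟨τ, hτ, rfl⟩
      exact ⟨fun i => ((τ i).act, (τ i).msg), hτ, rfl⟩
    · rintro ⟨x, hx, rfl⟩
      exact ⟨σ x, hx, rfl⟩
  rw [hE]
  exact (G.isClosed_setOf_isUSPPE η hδ₀.le hδ₁ ha hm).isCompact.image
    (G.continuous_contPayoff hδ₀.le hδ₁ ha hm [])
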